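/- Let $\mathbb K$ be a field, $n\ge 2$, ${\bf a}=(a_1,\dots,a_n)$ a vector of integers $a_i\ge 2$, and ${\bf q}=(q_{ij})$ an $n\times n$ matrix over $\mathbb K$ with $q_{ii}=1$ and $q_{ij}q_{ji}=1$ for all $i,j$. Let $$A=A({\bf q},{\bf a})=\mathbb K\langle x_1,\dots,x_n\rangle/\langle x_i^{a_i},\ x_jx_i-q_{ij}x_ix_j,\ 1\le i,j\le n\rangle$$ be the quantum complete intersection, $V=\{{\bf v}\in\mathbb N_0^n \mid v_i\le a_i-1,\ 1\le i\le n\}$, and $x_{\bf v}=x_1^{v_1}\cdots x_n^{v_n}$ for ${\bf v}\in V$. A permutation $\pi\in S_n$ is called compatible if $a_{\pi(i)}=a_i$ and $q_{\pi(i)\pi(j)}=q_{ji}$ for all $1\le i,j\le n$. Let $(A,\phi,t,S)$ be a bi-Frobenius algebra structure on $A$; that is, $A$ carries a $\mathbb K$-coalgebra structure $(\Delta,\varepsilon)$ (write $\Delta(b)=\sum b_1\otimes b_2$), $t\in A$, $\phi\in A^*=\operatorname{Hom}_{\mathbb K}(A,\mathbb K)$, and $S:A\to A$ is the linear map $S(b)=\sum\phi(t_1b)t_2$,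 such that - $\varepsilon$ is an algebra homomorphism and $\Delta(1)=1\otimes 1$; - every element of $A^*$ has the form $x\mapsto\phi(xb)$ with $b\in A$, and every element of $A$ has the form $\sum f(t_1)t_2$ with $f\in A^*$; - $S(1)=1$ and $S(bc)=S(c)S(b)$, $\varepsilon\circ S=\varepsilon$ and $\Delta(S(b))=\sum S(b_2)\otimes S(b_1)$ for all $b,c\in A$. Then the following statements are equivalent: 1. $S$ is a permutation antipode, i.e. there are a permutation $\sigma$ of $V$ and $c_{\bf v}\in\mathbb K$ such that $S(x_{\bf v})=c_{\bf v}x_{\sigma({\bf v})}$ for all ${\bf v}\in V$; 2. there are $\pi\in S_n$ and $c_i\in\mathbb K$ such that $S(x_i)=c_ix_{\pi(i)}$ for $1\le i\le n$; 3. there are a compatible permutation $\pi\in S_n$ and $c_i\in\mathbb K$ such that $S(x_i)=c_ix_{\pi(i)}$ for $1\le i\le n$. -/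

import Mathlib

open scoped TensorProduct

/-- The defining relations `x_i ^ a_i = 0` and `x_j x_i = q_{ij} x_i x_j`, on the free algebra
`K⟨x_1, …, x_n⟩`. -/
inductive QuantumCompleteIntersection.Rel {K : Type*} [Field K] {n : ℕ}
    (q : Matrix (Fin n) (Fin n) K) (a : Fin n → ℕ) :
    FreeAlgebra K (Fin n) → FreeAlgebra K (Fin n) → Prop
  | pow (i : Fin n) :
      QuantumCompleteIntersection.Rel q a (FreeAlgebra.ι K i ^ a i) 0
  | comm (i j : Fin n) :
      QuantumCompleteIntersection.Rel q a (FreeAlgebra.ι K j * FreeAlgebra.ι K i)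
        (q i j • (FreeAlgebra.ι K i * FreeAlgebra.ι K j))

/-- The algebra `A(q, a) = K⟨x_1, …, x_n⟩ / (x_i ^ a_i, x_j x_i - q_{ij} x_i x_j)`. -/
abbrev QuantumCompleteIntersection {K : Type*} [Field K] {n : ℕ}
    (q : Matrix (Fin n) (Fin n) K) (a : Fin n → ℕ) : Type _ :=
  RingQuot (QuantumCompleteIntersection.Rel q a)

namespace QuantumCompleteIntersection

variable {K : Type*} [Field K] {n : ℕ} (q : Matrix (Fin n) (Fin n) K) (a : Fin n → ℕ)

/-- The generator `x_i` of `A(q, a)`. -/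
def x (i : Fin n) : QuantumCompleteIntersection q a :=
  RingQuot.mkAlgHom K (Rel q a) (FreeAlgebra.ι K i)

/-- The ordered monomial `x_v = x_1 ^ v_1 ⋯ x_n ^ v_n` in `A(q, a)`. -/
def monomial (v : Fin n → ℕ) : QuantumCompleteIntersection q a :=
  (List.ofFn fun i => x q a i ^ v i).prod

/-- A linear endomorphism `S` of `A(q, a)` acts on the standard basis `x_v`, `0 ≤ v_i ≤ a_i - 1`,
through a permutation of the exponent vectors and scalars: `S(x_v) = c_v x_{σ(v)}`.
The set of exponent vectors is the type `∀ i, Fin (a i)`. -/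
def IsPermutationAntipode
    (S : QuantumCompleteIntersection q a →ₗ[K] QuantumCompleteIntersection q a) : Prop :=
  ∃ (σ : Equiv.Perm (∀ i, Fin (a i))) (c : (∀ i, Fin (a i)) → K),
    ∀ v : ∀ i, Fin (a i),
      S (monomial q a fun i => (v i : ℕ)) = c v • monomial q a fun i => (σ v i : ℕ)

/-- A permutation `π ∈ S_n` is compatible with `A(q, a)` if `a_{π(i)} = a_i` and
`q_{π(i)π(j)} = q_{ji}` for all `i`, `j`. -/
def IsCompatible (π : Equiv.Perm (Fin n)) : Prop :=
  (∀ i, a (π i) = a i) ∧ ∀ i j, q (π i) (π j) = q j i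

end QuantumCompleteIntersection

/-- The right action of `f ∈ C^*` on a coalgebra `C`: `t ↼ f = ∑ f(t₁) t₂`. -/
noncomputable def Coalgebra.rightHit {K C : Type*} [Field K] [AddCommGroup C] [Module K C]
    [Coalgebra K C] (t : C) (f : Module.Dual K C) : C :=
  TensorProduct.lid K C (LinearMap.rTensor C f (Coalgebra.comul (R := K) t))

/-- `(A, φ, t, S)` is a bi-Frobenius algebra, for an algebra and coalgebra `A` over `K`.
The functional `x ↦ φ(x b)` is the left translate `b ⇀ φ`. -/
structure IsBiFrobenius {K A : Type*} [Field K] [Ring A] [Algebra K A] [Coalgebra K A]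
    (φ : Module.Dual K A) (t : A) (S : A →ₗ[K] A) : Prop where
  finiteDimensional : FiniteDimensional K A
  /-- `S(b) = ∑ φ(t₁ b) t₂`. -/
  antipode_eq : ∀ b : A, S b = Coalgebra.rightHit t (φ ∘ₗ LinearMap.mulRight K b)
  counit_one : Coalgebra.counit (R := K) (1 : A) = 1
  counit_mul : ∀ b c : A, Coalgebra.counit (R := K) (b * c) =
    Coalgebra.counit (R := K) b * Coalgebra.counit (R := K) c
  comul_one : Coalgebra.comul (R := K) (1 : A) = (1 : A) ⊗ₜ[K] (1 : A)
  /-- `(A, φ)` is a Frobenius algebra: `A^* = A ⇀ φ`. -/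
  frobenius : ∀ f : Module.Dual K A, ∃ b : A, f = φ ∘ₗ LinearMap.mulRight K b
  /-- `(A, t)` is a Frobenius coalgebra: `A = t ↼ A^*`. -/
  coFrobenius : ∀ b : A, ∃ f : Module.Dual K A, b = Coalgebra.rightHit t f
  map_one : S 1 = 1
  map_mul : ∀ b c : A, S (b * c) = S c * S b
  counit_map : ∀ b : A, Coalgebra.counit (R := K) (S b) = Coalgebra.counit (R := K) b
  /-- `Δ(S(b)) = ∑ S(b₂) ⊗ S(b₁)`. -/
  comul_map : ∀ b : A, Coalgebra.comul (R := K) (S b) =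
    TensorProduct.map S S (TensorProduct.comm K A A (Coalgebra.comul (R := K) b))

namespace QuantumCompleteIntersection

/-! ### Maps out of the algebra, and nonvanishing of small monomials. -/

section Algebra

variable {K : Type*} [Field K] {n : ℕ} {q : Matrix (Fin n) (Fin n) K} {a : Fin n → ℕ}

/-! The coalgebra structure matters only through `IsBiFrobenius.bijective`; otherwise `S` is just a
linear anti-automorphism. If `S` permutes the generators up to scalars, applying it to the relations
yields compatibility (`isCompatible_of_map_x`), because the powers and products involved do not
vanish. It also sends each monomial to a reversed product, which can be reordered up to a scalar.
Conversely, if `S` permutes monomials up to scalars, compose its inverse with the map to the dual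
numbers sending `x_i` to `eps` and the other generators to `0`. This is multiplicative, so it kills
monomials of degree at least two, yet sends `S(x_i)` to `eps`. Hence `S(x_i)` is a multiple of a
generator. -/

theorem x_pow (i : Fin n) : x q a i ^ a i = 0 := by
  have h := RingQuot.mkAlgHom_rel K (Rel.pow (q := q) (a := a) i)
  rwa [map_pow, map_zero] at h

theorem x_mul_x (i j : Fin n) : x q a j * x q a i = q i j • (x q a i * x q a j) := by
  have h := RingQuot.mkAlgHom_rel K (Rel.comm (q := q) (a := a) i j)
  rwa [_root_.map_mul, map_smul, _root_.map_mul] at h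

theorem exists_algHom {B : Type*} [Ring B] [Algebra K B] (y : Fin n → B)
    (hpow : ∀ i, y i ^ a i = 0) (hcomm : ∀ i j, y j * y i = q i j • (y i * y j)) :
    ∃ f : QuantumCompleteIntersection q a →ₐ[K] B, ∀ i, f (x q a i) = y i := by
  have h : ∀ ⦃u v⦄, Rel q a u v → FreeAlgebra.lift K y u = FreeAlgebra.lift K y v := by
    rintro u v (⟨i⟩ | ⟨i, j⟩)
    · simp [hpow]
    · simp [hcomm i j]
  refine ⟨RingQuot.liftAlgHom K ⟨FreeAlgebra.lift K y, h⟩, fun i => ?_⟩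
  rw [x, RingQuot.liftAlgHom_mkAlgHom_apply, FreeAlgebra.lift_ι_apply]

/-- A homomorphism onto a one-variable algebra, killing all generators but `x_j`. -/
theorem exists_algHom_single (hq : ∀ i, q i i = 1) (ha : ∀ i, 2 ≤ a i) {B : Type*} [Ring B]
    [Algebra K B] (j : Fin n) (y : B) (hy : y ^ a j = 0) :
    ∃ f : QuantumCompleteIntersection q a →ₐ[K] B,
      f (x q a j) = y ∧ ∀ i, i ≠ j → f (x q a i) = 0 := by
  obtain ⟨f, hf⟩ := exists_algHom (q := q) (a := a) (fun i => if i = j then y else 0)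
    (fun i => by
      by_cases h : i = j
      · subst h; simpa using hy
      · have := ha i
        simp only [if_neg h]
        exact zero_pow (by omega))
    (fun i k => by
      by_cases h : i = j
      · by_cases h' : k = j
        · subst h; subst h'; simp [hq]
        · simp [h']
      · simp [h])
  exact ⟨f, by simp [hf], fun i hi => by simp [hf, hi]⟩

theorem x_pow_ne_zero (hq : ∀ i, q i i = 1) (ha : ∀ i, 2 ≤ a i) (j : Fin n) {m : ℕ}
    (hm : m < a j) : x q a j ^ m ≠ 0 := by
  open Polynomial in
  obtain ⟨f, hf, -⟩ := exists_algHom_single (q := q) hq ha j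
    (Ideal.Quotient.mkₐ K (Ideal.span {(X : K[X]) ^ a j}) X) (by
      rw [← map_pow, Ideal.Quotient.mkₐ_eq_mk, Ideal.Quotient.eq_zero_iff_mem]
      exact Ideal.mem_span_singleton_self _)
  intro h
  have h' := congrArg f h
  rw [map_pow, hf, map_zero, ← map_pow, Ideal.Quotient.mkₐ_eq_mk,
    Ideal.Quotient.eq_zero_iff_mem, Ideal.mem_span_singleton,
    pow_dvd_pow_iff Polynomial.X_ne_zero Polynomial.not_isUnit_X] at h'
  omega

theorem x_mul_x_ne_zero (hq' : ∀ i j, q i j * q j i = 1)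
    (ha : ∀ i, 2 ≤ a i) {i j : Fin n} (hij : i ≠ j) : x q a i * x q a j ≠ 0 := by
  -- Left multiplication by `x_i` and `x_j` on the span of `1, x_i, x_j, x_i x_j`, with both squares
  -- set to zero.
  let X : Matrix (Fin 4) (Fin 4) K := !![0,0,0,0; 1,0,0,0; 0,0,0,0; 0,0,1,0]
  let Y : Matrix (Fin 4) (Fin 4) K := !![0,0,0,0; 0,0,0,0; 1,0,0,0; 0,q i j,0,0]
  have hX : X * X = 0 := by
    ext r s; fin_cases r <;> fin_cases s <;> simp [X, Matrix.mul_apply, Fin.sum_univ_four]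
  have hY : Y * Y = 0 := by
    ext r s; fin_cases r <;> fin_cases s <;> simp [Y, Matrix.mul_apply, Fin.sum_univ_four]
  have hYX : Y * X = q i j • (X * Y) := by
    ext r s
    fin_cases r <;> fin_cases s <;> simp [X, Y, Matrix.mul_apply, Fin.sum_univ_four]
  have hXY : X * Y = q j i • (Y * X) := by
    rw [hYX, smul_smul, hq', one_smul]
  obtain ⟨f, hf⟩ := exists_algHom (q := q) (a := a)
    (fun k => if k = i then X else if k = j then Y else 0)
    (fun k => by
      refine pow_eq_zero_of_le (ha k) ?_
      rw [sq]
      split_ifs <;> simp [hX, hY])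
    (fun k l => by
      by_cases hk : k = i
      · by_cases hl : l = i
        · simp [hk, hl, hX]
        · by_cases hl' : l = j
          · simp only [hk, hl', if_neg hij.symm, if_true, hYX]
          · simp [hl, hl']
      · by_cases hk' : k = j
        · by_cases hl : l = i
          · simp only [hk', hl, if_neg hij.symm, if_true, hXY]
          · by_cases hl' : l = j
            · simp [hk', hl', hij.symm, hY]
            · simp [hl, hl']
        · simp [hk, hk'])
  intro h
  have h' := congrArg f h
  rw [_root_.map_mul, hf, hf, map_zero] at h'
  have h'' := congrFun (congrFun h' 3) 0
  simp [hij.symm, X, Y, Matrix.mul_apply, Fin.sum_univ_four] at h''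

end Algebra

/-! ### Reordering products up to unspecified scalars. -/

section Commutation

variable {K B : Type*} [Field K] [Ring B] [Algebra K B]

theorem exists_mul_pow_eq_smul {u v : B} (h : ∃ c : K, u * v = c • (v * u)) (k : ℕ) :
    ∃ c : K, u * v ^ k = c • (v ^ k * u) := by
  obtain ⟨c, hc⟩ := h
  refine ⟨c ^ k, ?_⟩
  induction k with
  | zero => simp
  | succ k ih =>
    rw [pow_succ v, ← mul_assoc, ih, smul_mul_assoc, mul_assoc, hc, mul_smul_comm, smul_smul,
      mul_assoc, pow_succ]

theorem exists_pow_mul_eq_smul {u v : B} (h : ∃ c : K, u * v = c • (v * u)) (k : ℕ) :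
    ∃ c : K, u ^ k * v = c • (v * u ^ k) := by
  obtain ⟨c, hc⟩ := h
  refine ⟨c ^ k, ?_⟩
  induction k with
  | zero => simp
  | succ k ih =>
    rw [pow_succ' u, mul_assoc, ih, mul_smul_comm, ← mul_assoc, hc, smul_mul_assoc, smul_smul,
      mul_assoc, pow_succ]

theorem exists_prod_map_eq_smul_of_perm {ι : Type*} (y : ι → B)
    (hy : ∀ i j, ∃ c : K, y i * y j = c • (y j * y i)) {l l' : List ι} (h : l.Perm l') :
    ∃ c : K, (l.map y).prod = c • (l'.map y).prod := by
  induction h with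
  | nil => exact ⟨1, by simp⟩
  | cons i _ ih =>
    obtain ⟨c, hc⟩ := ih
    exact ⟨c, by rw [List.map_cons, List.prod_cons, hc, List.map_cons, List.prod_cons,
      mul_smul_comm]⟩
  | swap i j l =>
    obtain ⟨c, hc⟩ := hy j i
    refine ⟨c, ?_⟩
    simp only [List.map_cons, List.prod_cons]
    rw [← mul_assoc, hc, smul_mul_assoc, mul_assoc]
  | trans _ _ ih ih' =>
    obtain ⟨c, hc⟩ := ih
    obtain ⟨d, hd⟩ := ih'
    exact ⟨c * d, by rw [hc, hd, smul_smul]⟩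

theorem exists_prod_map_smul {ι : Type*} (c : ι → K) (y : ι → B) (l : List ι) :
    ∃ d : K, (l.map fun i => c i • y i).prod = d • (l.map y).prod := by
  induction l with
  | nil => exact ⟨1, by simp⟩
  | cons i l ih =>
    obtain ⟨d, hd⟩ := ih
    refine ⟨c i * d, ?_⟩
    rw [List.map_cons, List.prod_cons, hd, smul_mul_smul_comm, List.map_cons, List.prod_cons]

end Commutation

section Antihomomorphism

variable {B : Type*} [Ring B] {S : B → B}

theorem antihom_list_prod (h1 : S 1 = 1) (hm : ∀ b c, S (b * c) = S c * S b) (l : List B) :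
    S l.prod = (l.reverse.map S).prod := by
  induction l with
  | nil => simpa using h1
  | cons b l ih => simp [hm, ih]

theorem antihom_pow (h1 : S 1 = 1) (hm : ∀ b c, S (b * c) = S c * S b) (b : B) (k : ℕ) :
    S (b ^ k) = S b ^ k := by
  induction k with
  | zero => simpa using h1
  | succ k ih => rw [pow_succ, hm, ih, ← pow_succ']

end Antihomomorphism

/-! ### Detecting monomials of degree one. -/

section DualNumber

variable {K : Type*} [Field K] {n : ℕ} {q : Matrix (Fin n) (Fin n) K} {a : Fin n → ℕ}

theorem dualNumber_mul_eq_zero {u v : DualNumber K} (hu : IsNilpotent u) (hv : IsNilpotent v) :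
    u * v = 0 := by
  have key : ∀ w : DualNumber K, IsNilpotent w → w.fst = 0 := fun w hw =>
    (hw.map (TrivSqZeroExt.fstHom K K K)).eq_zero
  ext <;> simp [key u hu, key v hv]

/-- A multiplicative map to the dual numbers kills every monomial of degree at least two. -/
theorem map_monomial_eq_zero (ψ : QuantumCompleteIntersection q a →* DualNumber K)
    (h0 : ψ 0 = 0) {u : Fin n → ℕ} (hu0 : u ≠ 0) (hu1 : ∀ j, u ≠ Pi.single j 1) :
    ψ (monomial q a u) = 0 := by
  have hnil : ∀ k, IsNilpotent (ψ (x q a k)) := fun k => ⟨a k, by rw [← map_pow, x_pow, h0]⟩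
  have hnil' : ∀ k {m : ℕ}, m ≠ 0 → IsNilpotent (ψ (x q a k) ^ m) := fun k m hm =>
    (hnil k).pow_of_pos hm
  obtain ⟨k, hk⟩ := Function.ne_iff.mp hu0
  have hk : u k ≠ 0 := hk
  rw [monomial, map_list_prod, List.map_ofFn, List.prod_ofFn,
    ← Finset.mul_prod_erase _ _ (Finset.mem_univ k)]
  simp only [Function.comp_apply, map_pow]
  by_cases h2 : 2 ≤ u k
  · rw [pow_eq_zero_of_le h2 (by rw [sq]; exact dualNumber_mul_eq_zero (hnil k) (hnil k)),
      zero_mul]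
  -- Here `u k = 1`, so a second variable must occur.
  · obtain ⟨l, hl⟩ := Function.ne_iff.mp (hu1 k)
    have hlk : l ≠ k := by
      rintro rfl
      rw [Pi.single_eq_same] at hl
      omega
    rw [Pi.single_eq_of_ne hlk] at hl
    rw [← Finset.mul_prod_erase _ _ (Finset.mem_erase.mpr ⟨hlk, Finset.mem_univ l⟩), ← mul_assoc,
      dualNumber_mul_eq_zero (hnil' k hk) (hnil' l hl), zero_mul]

theorem monomial_zero : monomial q a 0 = 1 := by
  simp [monomial]

theorem monomial_single (j : Fin n) : monomial q a (Pi.single j 1) = x q a j := by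
  rw [monomial, List.ofFn_eq_map,
    List.prod_map_eq_pow_single j _ fun i hi _ => by rw [Pi.single_eq_of_ne hi, pow_zero],
    List.count_eq_one_of_mem (List.nodup_finRange n) (List.mem_finRange j), pow_one,
    Pi.single_eq_same, pow_one]

end DualNumber

end QuantumCompleteIntersection

/-- `S` is the composite of the two surjections in the Frobenius conditions; finite dimension does
the rest. -/
theorem IsBiFrobenius.bijective {K A : Type*} [Field K] [Ring A] [Algebra K A] [Coalgebra K A]
    {φ : Module.Dual K A} {t : A} {S : A →ₗ[K] A} (hS : IsBiFrobenius φ t S) :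
    Function.Bijective S := by
  have := hS.finiteDimensional
  have hsurj : Function.Surjective S := fun b => by
    obtain ⟨f, hf⟩ := hS.coFrobenius b
    obtain ⟨c, rfl⟩ := hS.frobenius f
    exact ⟨c, by rw [hS.antipode_eq, ← hf]⟩
  exact ⟨LinearMap.injective_iff_surjective.mpr hsurj, hsurj⟩

namespace QuantumCompleteIntersection

/-! ### The three implications for a linear anti-endomorphism. -/

section Antiautomorphism

variable {K : Type*} [Field K] {n : ℕ} {q : Matrix (Fin n) (Fin n) K} {a : Fin n → ℕ}
  {S : QuantumCompleteIntersection q a →ₗ[K] QuantumCompleteIntersection q a}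

theorem coeff_ne_zero (hq : ∀ i, q i i = 1) (ha : ∀ i, 2 ≤ a i) (hinj : Function.Injective S)
    {i : Fin n} {c : K} {y : QuantumCompleteIntersection q a} (h : S (x q a i) = c • y) :
    c ≠ 0 := by
  rintro rfl
  rw [zero_smul] at h
  have hx := x_pow_ne_zero (q := q) hq ha i (m := 1) (ha i)
  rw [pow_one] at hx
  exact hx (hinj (by rw [h, map_zero]))

theorem isCompatible_of_map_x (hq : ∀ i, q i i = 1) (hq' : ∀ i j, q i j * q j i = 1)
    (ha : ∀ i, 2 ≤ a i) (hinj : Function.Injective S) (h1 : S 1 = 1)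
    (hm : ∀ b c, S (b * c) = S c * S b) {π : Equiv.Perm (Fin n)} {c : Fin n → K}
    (h : ∀ i, S (x q a i) = c i • x q a (π i)) : IsCompatible q a π := by
  have hc : ∀ i, c i ≠ 0 := fun i => coeff_ne_zero hq ha hinj (h i)
  constructor
  · have hle : ∀ i, a (π i) ≤ a i := by
      intro i
      by_contra! hlt
      have h0 := antihom_pow h1 hm (x q a i) (a i)
      rw [x_pow, map_zero, h, smul_pow, eq_comm,
        smul_eq_zero_iff_right (pow_ne_zero _ (hc i))] at h0
      exact x_pow_ne_zero hq ha (π i) hlt h0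
    -- Equal sums turn the termwise inequality into equality.
    have hsum : ∑ i, a (π i) = ∑ i, a i := Equiv.sum_comp π a
    intro i
    exact (Finset.sum_eq_sum_iff_of_le fun i _ => hle i).mp hsum i (Finset.mem_univ i)
  · intro i j
    rcases eq_or_ne i j with rfl | hij
    · rw [hq, hq]
    -- Reversing both products in this relation is what transposes the indices of `q`.
    have h0 := congrArg S (x_mul_x (q := q) (a := a) j i)
    rw [hm, map_smul, hm, h, h, smul_mul_smul_comm, smul_mul_smul_comm, smul_smul,
      x_mul_x (π i) (π j), smul_smul, mul_comm (c i) (c j)] at h0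
    have h3 := smul_left_injective K
      (x_mul_x_ne_zero (q := q) hq' ha (π.injective.ne hij)) h0
    have h4 : c j * c i ≠ 0 := mul_ne_zero (hc j) (hc i)
    rw [mul_comm] at h3
    exact mul_right_cancel₀ h4 h3

theorem isPermutationAntipode_of_map_x (h1 : S 1 = 1)
    (hm : ∀ b c, S (b * c) = S c * S b) {π : Equiv.Perm (Fin n)} {c : Fin n → K}
    (hπ : ∀ i, a (π i) = a i) (h : ∀ i, S (x q a i) = c i • x q a (π i)) :
    IsPermutationAntipode q a S := by
  have hπ' : ∀ i, a (π.symm i) = a i := fun i => by rw [← hπ (π.symm i), π.apply_symm_apply]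
  have key : ∀ v : Fin n → ℕ, ∃ d : K,
      S (monomial q a v) = d • monomial q a fun i => v (π.symm i) := by
    intro v
    set y : Fin n → QuantumCompleteIntersection q a := fun k => x q a k ^ v (π.symm k) with hy
    have hcomm : ∀ i j, ∃ d : K, y i * y j = d • (y j * y i) := fun i j =>
      exists_pow_mul_eq_smul (exists_mul_pow_eq_smul ⟨q j i, x_mul_x j i⟩ _) _
    obtain ⟨d, hd⟩ := exists_prod_map_smul (fun i => c i ^ v i) (fun i => y (π i))
      (List.finRange n).reverse
    have hperm : ((List.finRange n).reverse.map π).Perm (List.finRange n) := by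
      refine (List.perm_ext_iff_of_nodup ?_ (List.nodup_finRange n)).mpr fun k => ?_
      · exact (List.nodup_reverse.mpr (List.nodup_finRange n)).map π.injective
      · simp only [List.mem_finRange, iff_true, List.mem_map, List.mem_reverse, true_and]
        exact π.surjective k
    obtain ⟨e, he⟩ := exists_prod_map_eq_smul_of_perm y hcomm hperm
    refine ⟨d * e, ?_⟩
    rw [monomial, antihom_list_prod h1 hm, List.ofFn_eq_map, ← List.map_reverse, List.map_map,
      monomial, List.ofFn_eq_map, mul_smul, ← he, List.map_map]
    refine Eq.trans ?_ hd
    congr 1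
    refine List.map_congr_left fun i _ => ?_
    simp only [Function.comp_apply, hy, π.symm_apply_apply]
    rw [antihom_pow h1 hm, h, smul_pow]
  choose d hd using key
  let σ : Equiv.Perm (∀ i, Fin (a i)) :=
    { toFun := fun v i => Fin.cast (hπ' i) (v (π.symm i))
      invFun := fun v i => Fin.cast (hπ i) (v (π i))
      left_inv := fun v => by
        funext i
        apply Fin.ext
        simp only [Fin.val_cast]
        rw [π.symm_apply_apply]
      right_inv := fun v => by
        funext i
        apply Fin.ext
        simp only [Fin.val_cast]
        rw [π.apply_symm_apply] }
  exact ⟨σ, fun v => d fun i => v i, fun v => hd fun i => v i⟩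

theorem exists_map_x_of_isPermutationAntipode (hq : ∀ i, q i i = 1) (ha : ∀ i, 2 ≤ a i)
    (hbij : Function.Bijective S) (h1 : S 1 = 1) (hm : ∀ b c, S (b * c) = S c * S b)
    (h : IsPermutationAntipode q a S) :
    ∃ (π : Equiv.Perm (Fin n)) (c : Fin n → K), ∀ i, S (x q a i) = c i • x q a (π i) := by
  obtain ⟨σ, c, hσ⟩ := h
  let e : Fin n → ∀ i, Fin (a i) := fun j i =>
    ⟨(Pi.single j 1 : Fin n → ℕ) i, lt_of_le_of_lt
      (by rcases eq_or_ne i j with rfl | hij <;> simp [*]) (ha i)⟩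
  have hx : ∀ i, S (x q a i) = c (e i) • monomial q a fun k => (σ (e i) k : ℕ) := fun i => by
    rw [← hσ, ← monomial_single]
  have hc : ∀ i, c (e i) ≠ 0 := fun i => coeff_ne_zero hq ha hbij.1 (hx i)
  have hdeg : ∀ i, ∃ j, (fun k => (σ (e i) k : ℕ)) = Pi.single j 1 := by
    intro i
    by_contra! hne
    obtain ⟨f, hf, -⟩ := exists_algHom_single (q := q) hq ha i (DualNumber.eps : DualNumber K)
      (pow_eq_zero_of_le (ha i) DualNumber.eps_pow_two)
    let T := (LinearEquiv.ofBijective S hbij).symm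
    have hST : ∀ b, S (T b) = b := (LinearEquiv.ofBijective S hbij).apply_symm_apply
    have hTS : ∀ b, T (S b) = b := (LinearEquiv.ofBijective S hbij).symm_apply_apply
    let ψ : QuantumCompleteIntersection q a →* DualNumber K :=
      { toFun := fun b => f (T b)
        map_one' := by rw [← h1, hTS, map_one]
        -- Commutativity of the dual numbers absorbs the order reversal.
        map_mul' := fun b d => by
          have : T (b * d) = T d * T b := hbij.1 (by rw [hST, hm, hST, hST])
          rw [this, map_mul, mul_comm] }
    have hψ : ψ (S (x q a i)) = DualNumber.eps := by
      change f (T _) = _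
      rw [hTS, hf]
    have hψ_smul : ∀ (k : K) b, ψ (k • b) = k • ψ b := fun k b => by
      change f (T _) = k • f (T _)
      rw [map_smul, map_smul]
    have heps : (DualNumber.eps : DualNumber K) ≠ 0 := fun h0 => by
      simpa using congrArg TrivSqZeroExt.snd h0
    rw [hx, hψ_smul] at hψ
    -- A nonzero multiple of `1` has nonzero constant part, unlike `eps`.
    by_cases h0 : (fun k => (σ (e i) k : ℕ)) = 0
    · rw [h0, monomial_zero, map_one] at hψ
      have := congrArg TrivSqZeroExt.fst hψ
      simp [hc] at this
    · rw [map_monomial_eq_zero ψ (by change f (T 0) = 0; simp) h0 hne, smul_zero] at hψ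
      exact heps hψ.symm
  choose p hp using hdeg
  have he_inj : Function.Injective e := fun i j hij => by
    have h2 := congrArg Fin.val (congrFun hij i)
    by_contra hne
    simp [e, hne] at h2
  have hp_inj : Function.Injective p := fun i j hij => by
    apply he_inj
    apply σ.injective
    funext k
    apply Fin.ext
    have h2 := (hp i).trans (hij ▸ (hp j).symm)
    exact congrFun h2 k
  refine ⟨Equiv.ofBijective p (Finite.injective_iff_bijective.mp hp_inj), fun i => c (e i),
    fun i => ?_⟩
  rw [hx, hp, monomial_single, Equiv.ofBijective_apply]

end Antiautomorphism

end QuantumCompleteIntersection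

theorem proposition5p4 {K : Type*} [Field K] {n : ℕ} (hn : 2 ≤ n)
    (q : Matrix (Fin n) (Fin n) K) (a : Fin n → ℕ)
    (ha : ∀ i, 2 ≤ a i) (hq_diag : ∀ i, q i i = 1) (hq_mul : ∀ i j, q i j * q j i = 1)
    [Coalgebra K (QuantumCompleteIntersection q a)]
    (φ : Module.Dual K (QuantumCompleteIntersection q a))
    (t : QuantumCompleteIntersection q a)
    (S : QuantumCompleteIntersection q a →ₗ[K] QuantumCompleteIntersection q a)
    (hS : IsBiFrobenius φ t S) :
    List.TFAE [
      QuantumCompleteIntersection.IsPermutationAntipode q a S,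
      ∃ (π : Equiv.Perm (Fin n)) (c : Fin n → K), ∀ i,
        S (QuantumCompleteIntersection.x q a i) =
          c i • QuantumCompleteIntersection.x q a (π i),
      ∃ (π : Equiv.Perm (Fin n)) (c : Fin n → K),
        QuantumCompleteIntersection.IsCompatible q a π ∧ ∀ i,
          S (QuantumCompleteIntersection.x q a i) =
            c i • QuantumCompleteIntersection.x q a (π i)] := by
  have hbij := hS.bijective
  tfae_have 3 → 2 := fun ⟨π, c, _, h⟩ => ⟨π, c, h⟩
  tfae_have 2 → 3 := fun ⟨π, c, h⟩ =>
    ⟨π, c, QuantumCompleteIntersection.isCompatible_of_map_x hq_diag hq_mul ha hbij.1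
      hS.map_one hS.map_mul h, h⟩
  tfae_have 3 → 1 := fun ⟨_, _, hπ, h⟩ =>
    QuantumCompleteIntersection.isPermutationAntipode_of_map_x hS.map_one hS.map_mul hπ.1 h
  tfae_have 1 → 2 :=
    QuantumCompleteIntersection.exists_map_x_of_isPermutationAntipode hq_diag ha hbij
      hS.map_one hS.map_mul
  tfae_finish
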